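/- Let $p_1,p_2,r$ be integers with $0<r\le\min\{p_1,p_2\}$, let $f:\mathbb{R}^{p_1\times p_2}\to\mathbb{R}$ be twice continuously differentiable, and let $\mu>0$. Let $\mathcal{M}_r=\{X\in\mathbb{R}^{p_1\times p_2}:\operatorname{rank}X=r\}$, an embedded submanifold of $\mathbb{R}^{p_1\times p_2}$ with the Riemannian metric induced by $\langle A,B\rangle=\operatorname{trace}(A^\top B)$. For $L\in\mathbb{R}^{p_1\times r}$ and $R\in\mathbb{R}^{p_2\times r}$ put $$g(L,R)=f(LR^\top),\qquad g_{\mathrm{reg}}(L,R)=f(LR^\top)+\frac{\mu}{2}\,\|L^\top L-R^\top R\|_{\mathrm F}^2 .$$ A point $x$ is a Euclidean FOSP of a function $h$ if $\nabla h(x)=0$, and a Euclidean SOSP if $\nabla h(x)=0$ and $\nabla^2h(x)\succcurlyeq0$. A matrix $X\in\mathcal{M}_r$ is a Riemannian FOSP of $f$ on $\mathcal{M}_r$ if $\operatorname{grad}f(X)=0$, and a Riemannian SOSP if $\operatorname{grad}f(X)=0$ and $\operatorname{Hess}f(X)\succcurlyeq0$. Here the Riemannian gradient $\operatorname{grad}f(X)\in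 T_X\mathcal{M}_r$ is the tangent vector with $\langle\operatorname{grad}f(X),Z\rangle=\mathrm{D}f(X)[Z]$ for all $Z\in T_X\mathcal{M}_r$, and the Riemannian Hessian is $\operatorname{Hess}f(X)[Z]=\overline{\nabla}_Z\operatorname{grad}f$, where $\overline{\nabla}$ is the Riemannian (Levi-Civita) connection of $\mathcal{M}_r$, that is, the orthogonal projection onto $T_X\mathcal{M}_r$ of the derivative of the field $\operatorname{grad}f$ along $Z$. (a) Let $L\in\mathbb{R}^{p_1\times r}$, $R\in\mathbb{R}^{p_2\times r}$ be such that $LR^\top$ has rank $r$. If $(L,R)$ is a Euclidean FOSP of $g$ or a Euclidean FOSP of $g_{\mathrm{reg}}$, then $X=LR^\top$ is a Riemannian FOSP of $f$ on $\mathcal{M}_r$. If $(L,R)$ is a Euclidean SOSP of $g$ or a Euclidean SOSP of $g_{\mathrm{reg}}$, then $X=LR^\top$ is a Riemannian SOSP of $f$ on $\mathcal{M}_r$. (b) Let $X$ be a Riemannian FOSP (respectively, SOSP) of $f$ on $\mathcal{M}_r$. Then every $(L,R)\in\mathbb{R}^{p_1\times r}\times\mathbb{R}^{p_2\times r}$ with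 $LR^\top=X$ is a Euclidean FOSP (respectively, SOSP) of $g$, and every such $(L,R)$ with $LR^\top=X$ and $L^\top L=R^\top R$ is a Euclidean FOSP (respectively, SOSP) of $g_{\mathrm{reg}}$. -/

import Mathlib

open scoped ContDiff Gradient Matrix InnerProductSpace

/-! ### The Euclidean space of real matrices: Frobenius norm and inner product -/

attribute [local instance] Matrix.frobeniusNormedAddCommGroup Matrix.frobeniusNormedSpace

/-- The inner product `⟪A, B⟫ = trace (Aᵀ B)` on real matrices; its norm is the Frobenius norm. -/
noncomputable instance matrixInnerProductSpace {m n : Type*} [Fintype m] [Fintype n] :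
    InnerProductSpace ℝ (Matrix m n ℝ) where
  inner A B := (Aᵀ * B).trace
  norm_sq_eq_re_inner A := by
    rw [Matrix.frobenius_norm_def, ← Real.sqrt_eq_rpow, Real.sq_sqrt (by positivity)]
    simp only [RCLike.re_to_real, Matrix.trace, Matrix.diag_apply, Matrix.mul_apply,
      Matrix.transpose_apply]
    rw [Finset.sum_comm]
    refine Finset.sum_congr rfl fun i _ => Finset.sum_congr rfl fun j _ => ?_
    rw [Real.rpow_two, Real.norm_eq_abs, sq_abs, sq]
  conj_inner_symm A B := by
    rw [conj_trivial, ← Matrix.trace_transpose, Matrix.transpose_mul, Matrix.transpose_transpose]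
  add_left A B C := by
    rw [Matrix.transpose_add, Matrix.add_mul, Matrix.trace_add]
  smul_left A B c := by
    rw [Matrix.transpose_smul, Matrix.smul_mul, Matrix.trace_smul, conj_trivial, smul_eq_mul]

/-! ### Euclidean stationary points -/

section Euclidean

variable {E : Type*} [NormedAddCommGroup E] [InnerProductSpace ℝ E] [CompleteSpace E]

/-- The Euclidean Hessian `∇²h(x)`: the derivative at `x` of the gradient field `∇h`. -/
noncomputable def euclideanHessian (h : E → ℝ) (x : E) : E →L[ℝ] E :=
  fderiv ℝ (fun y => ∇ h y) x

/-- `x` is a Euclidean first-order stationary point of `h`. -/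
def IsEuclideanFOSP (h : E → ℝ) (x : E) : Prop :=
  ∇ h x = 0

/-- `x` is a Euclidean second-order stationary point of `h`. -/
def IsEuclideanSOSP (h : E → ℝ) (x : E) : Prop :=
  ∇ h x = 0 ∧ ∀ z : E, 0 ≤ ⟪euclideanHessian h x z, z⟫_ℝ

end Euclidean

/-! ### Riemannian stationary points on an embedded submanifold `M` of a Euclidean space `E`,
with the metric induced by the inner product of `E` -/

section Riemannian

variable {E : Type*} [NormedAddCommGroup E] [InnerProductSpace ℝ E] [FiniteDimensional ℝ E]

/-- Velocities at `X` of smooth curves in `M` through `X`. -/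
def curveVelocities (M : Set E) (X : E) : Set E :=
  {Z | ∃ (γ : ℝ → E) (ε : ℝ), 0 < ε ∧ ContDiffOn ℝ ∞ γ (Set.Ioo (-ε) ε) ∧
    (∀ t ∈ Set.Ioo (-ε) ε, γ t ∈ M) ∧ γ 0 = X ∧ HasDerivAt γ Z 0}

/-- The tangent space `T_X M`. If `M` is an embedded submanifold, the velocities already form a
linear subspace, so that taking the span adds nothing. -/
def tangentSpaceOf (M : Set E) (X : E) : Submodule ℝ E :=
  Submodule.span ℝ (curveVelocities M X)

/-- The Riemannian gradient of `f` at `X`: the unique tangent vector `grad f(X) ∈ T_X M` with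
`⟪grad f(X), Z⟫ = D f(X)[Z]` for all `Z ∈ T_X M` (Riesz representation in `T_X M`). -/
noncomputable def riemannianGradient (M : Set E) (f : E → ℝ) (X : E) : tangentSpaceOf M X :=
  (InnerProductSpace.toDual ℝ (tangentSpaceOf M X)).symm
    ((fderiv ℝ f X).comp (tangentSpaceOf M X).subtypeL)

theorem inner_riemannianGradient (M : Set E) (f : E → ℝ) (X : E) (Z : tangentSpaceOf M X) :
    ⟪riemannianGradient M f X, Z⟫_ℝ = fderiv ℝ f X Z := by
  simp [riemannianGradient]

/-- The Riemannian gradient as a vector field along `M` with values in the ambient space. -/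
noncomputable def riemannianGradientField (M : Set E) (f : E → ℝ) (X : E) : E :=
  (riemannianGradient M f X : E)

/-- The Riemannian (Levi-Civita) connection of `M` with the induced metric: `∇̄_Z Y` at `X ∈ M` is
the tangential component of the derivative at `X`, along `Z ∈ T_X M`, of the tangent field `Y`
on `M`. The derivative is taken within `M`; on tangent vectors it only depends on `Y` along `M`. -/
noncomputable def riemannianConnection (M : Set E) (Y : E → E) (X : E) :
    tangentSpaceOf M X →L[ℝ] tangentSpaceOf M X :=
  (tangentSpaceOf M X).orthogonalProjectionOnto.comp
    ((fderivWithin ℝ Y M X).comp (tangentSpaceOf M X).subtypeL)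

theorem curveVelocities_subset_tangentConeAt {E : Type*} [NormedAddCommGroup E]
    [InnerProductSpace ℝ E] (M : Set E) (X : E) : curveVelocities M X ⊆ tangentConeAt ℝ M X := by
  rintro Z ⟨γ, ε, hε, -, hM, h0, hd⟩
  have h1 : HasDerivWithinAt γ Z (Set.Ioo (-ε) ε) 0 := hd.hasDerivWithinAt
  have h2 := h1.hasFDerivWithinAt.mapsTo_tangent_cone
  have h3 : (1 : ℝ) ∈ tangentConeAt ℝ (Set.Ioo (-ε) ε) 0 := by
    rw [tangentConeAt_of_mem_nhds (Ioo_mem_nhds (by linarith) hε)]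
    trivial
  have h4 := h2 h3
  simp only [h0, ContinuousLinearMap.toSpanSingleton_apply, one_smul] at h4
  exact tangentConeAt_mono (by rintro _ ⟨t, ht, rfl⟩; exact hM t ht) h4

/-- The connection does not depend on which derivative of `Y` within `M` is used. -/
theorem riemannianConnection_apply (M : Set E) (Y : E → E) (Y' : E →L[ℝ] E) (X : E)
    (h : HasFDerivWithinAt Y Y' M X) (Z : tangentSpaceOf M X) :
    riemannianConnection M Y X Z = (tangentSpaceOf M X).orthogonalProjectionOnto (Y' Z) := by
  have key : Set.EqOn (fderivWithin ℝ Y M X) Y' (tangentConeAt ℝ M X) :=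
    h.differentiableWithinAt.hasFDerivWithinAt.unique_on h
  have hZ : (Z : E) ∈ LinearMap.eqLocus (fderivWithin ℝ Y M X).toLinearMap Y'.toLinearMap := by
    refine Submodule.span_le.2 ?_ Z.2
    intro z hz
    exact key (curveVelocities_subset_tangentConeAt M X hz)
  simp only [riemannianConnection, ContinuousLinearMap.comp_apply]
  congr 1

/-- The Riemannian Hessian `Hess f(X)[Z] = ∇̄_Z grad f`. -/
noncomputable def riemannianHessian (M : Set E) (f : E → ℝ) (X : E) :
    tangentSpaceOf M X →L[ℝ] tangentSpaceOf M X :=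
  riemannianConnection M (riemannianGradientField M f) X

/-- `X ∈ M` is a Riemannian first-order stationary point of `f` on `M`. -/
def IsRiemannianFOSP (M : Set E) (f : E → ℝ) (X : E) : Prop :=
  X ∈ M ∧ riemannianGradient M f X = 0

/-- `X ∈ M` is a Riemannian second-order stationary point of `f` on `M`: the gradient vanishes, and
the Hessian exists (the gradient field is differentiable at `X` along `M`) and is positive
semidefinite on `T_X M`. -/
def IsRiemannianSOSP (M : Set E) (f : E → ℝ) (X : E) : Prop :=
  X ∈ M ∧ riemannianGradient M f X = 0 ∧
    DifferentiableWithinAt ℝ (riemannianGradientField M f) M X ∧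
    ∀ Z : tangentSpaceOf M X, 0 ≤ ⟪riemannianHessian M f X Z, Z⟫_ℝ

end Riemannian

/-! ### Fixed-rank matrices and the two factorized objectives -/

/-- The set `M_r` of `p₁ × p₂` real matrices of rank `r`. -/
def fixedRankManifold (p₁ p₂ r : ℕ) : Set (Matrix (Fin p₁) (Fin p₂) ℝ) :=
  {X | X.rank = r}

/-- The Euclidean space of pairs `(L, R)`, with `‖(L, R)‖² = ‖L‖_F² + ‖R‖_F²`. -/
abbrev FactorSpace (p₁ p₂ r : ℕ) : Type :=
  WithLp 2 (Matrix (Fin p₁) (Fin r) ℝ × Matrix (Fin p₂) (Fin r) ℝ)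

/-- The pair `(L, R)` as a point of `FactorSpace`. -/
def factorPair {p₁ p₂ r : ℕ} (L : Matrix (Fin p₁) (Fin r) ℝ) (R : Matrix (Fin p₂) (Fin r) ℝ) :
    FactorSpace p₁ p₂ r :=
  WithLp.toLp 2 (L, R)

/-- `g(L, R) = f(L Rᵀ)`. -/
def factorObjective {p₁ p₂ : ℕ} (r : ℕ) (f : Matrix (Fin p₁) (Fin p₂) ℝ → ℝ) :
    FactorSpace p₁ p₂ r → ℝ :=
  fun A => f (A.fst * A.sndᵀ)

/-- `g_reg(L, R) = f(L Rᵀ) + (μ / 2) ‖Lᵀ L - Rᵀ R‖_F²`. -/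
noncomputable def regFactorObjective {p₁ p₂ : ℕ} (r : ℕ) (f : Matrix (Fin p₁) (Fin p₂) ℝ → ℝ)
    (μ : ℝ) : FactorSpace p₁ p₂ r → ℝ :=
  fun A => f (A.fst * A.sndᵀ) + μ / 2 * ‖A.fstᵀ * A.fst - A.sndᵀ * A.snd‖ ^ 2

/-!
Let `w = (L, R)` be a pair of factors whose product `X = L Rᵀ` has rank `r`; both factors then have
full column rank. The theorem follows from two equivalences at such a `w`.

The stationary points of `g` and of `f` on the fixed-rank manifold correspond
(`isRiemannianFOSP_iff_isEuclideanFOSP`, `isRiemannianSOSP_iff_isEuclideanSOSP`). The tangent space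
at `X` is the range of the differential `(A, B) ↦ A Rᵀ + L Bᵀ` of the factorization map
(`tangentSpaceOf_fixedRankManifold`): one inclusion uses the curves `(L + tA)(R + tB)ᵀ`, the other a
differentiable local section of the factorization map, given by the skeleton decomposition
`Y = (Y V)(U Y V)⁻¹(U Y)` of matrices of rank `r` (`exists_factor_section`). By the chain rule the
gradients of `g` at `w` and of `f` along the manifold vanish together. For the Hessians,
differentiate `⟪grad f(γ), γ'⟫ = ⟪∇f(γ), γ'⟫` along `γ(t) = (L + tA)(R + tB)ᵀ`: at a critical point
the term with `γ''` drops out, so the Hessian form of `g` at `(A, B)` is the Riemannian Hessian form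
of `f` at `A Rᵀ + L Bᵀ` (`inner_euclideanHessian_factorObjective`). The same section, with the
explicit formula for the tangential projection, shows that the Riemannian gradient field is
differentiable along the manifold (`differentiableWithinAt_riemannianGradientField`).

The stationary points of `g_reg` are those of `g` which are balanced, that is, with `Δ = 0` for
`Δ = LᵀL - RᵀR` (`isEuclideanFOSP_regFactorObjective_iff`,
`isEuclideanSOSP_regFactorObjective_iff`).
Moving along `(LΔ, -RΔ)` does not change `L Rᵀ` to first order but changes `‖Δ‖²` at the rate
`4 (‖LΔ‖² + ‖RΔ‖²)`, so critical points of `g_reg` are balanced. At balanced factors the regularizer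
adds `μ ‖DΔ[z]‖²` to the Hessian form. This is nonnegative, and it vanishes after `z` is corrected
by a suitable `(LS, -RSᵀ)`, which leaves `A Rᵀ + L Bᵀ` unchanged; the matrix `S` solves a Lyapunov
equation (`exists_factorTangent_eq_factorImbalanceDeriv_eq_zero`).
-/

/-! ### Matrices of full column rank -/

section LinearAlgebra

variable {m n k : Type*} [Fintype m] [Fintype n] [Fintype k]

theorem Matrix.isUnit_of_card_le_rank [DecidableEq n] (A : Matrix n n ℝ)
    (h : Fintype.card n ≤ A.rank) : IsUnit A := by
  rw [← Matrix.mulVec_surjective_iff_isUnit]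
  have h1 : LinearMap.range A.mulVecLin = ⊤ := by
    apply Submodule.eq_top_of_finrank_eq
    rw [Module.finrank_fintype_fun_eq_card]
    exact le_antisymm A.rank_le_card_width h
  exact LinearMap.range_eq_top.1 h1

/-- The left inverse `(LᵀL)⁻¹Lᵀ` of a matrix of full column rank. -/
noncomputable def Matrix.gramLeftInv [DecidableEq n] (L : Matrix m n ℝ) : Matrix n m ℝ :=
  (Lᵀ * L)⁻¹ * Lᵀ

theorem Matrix.isUnit_gram [DecidableEq n] {L : Matrix m n ℝ} (h : Fintype.card n ≤ L.rank) :
    IsUnit (Lᵀ * L) :=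
  Matrix.isUnit_of_card_le_rank _ (by rwa [Matrix.rank_transpose_mul_self])

theorem Matrix.gramLeftInv_mul [DecidableEq n] {L : Matrix m n ℝ}
    (h : Fintype.card n ≤ L.rank) : L.gramLeftInv * L = 1 := by
  rw [gramLeftInv, Matrix.mul_assoc, Matrix.nonsing_inv_mul]
  exact (Matrix.isUnit_iff_isUnit_det _).1 (isUnit_gram h)

/-- `L L⁺` is the orthogonal projection onto the column space of `L`, so its complement is
annihilated by `Lᵀ`. -/
theorem Matrix.transpose_mul_one_sub_gramLeftInv [DecidableEq n] [DecidableEq m]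
    {L : Matrix m n ℝ} (h : Fintype.card n ≤ L.rank) : Lᵀ * (1 - L * L.gramLeftInv) = 0 := by
  rw [gramLeftInv, Matrix.mul_sub, Matrix.mul_one, ← Matrix.mul_assoc, ← Matrix.mul_assoc,
    Matrix.mul_nonsing_inv _ ((Matrix.isUnit_iff_isUnit_det _).1 (isUnit_gram h)),
    Matrix.one_mul, sub_self]

omit [Fintype k] in
theorem Matrix.eq_zero_of_mul_eq_zero_of_card_le_rank {L : Matrix m n ℝ}
    (h : Fintype.card n ≤ L.rank) {S : Matrix n k ℝ} (hS : L * S = 0) : S = 0 := by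
  classical
  rw [← Matrix.one_mul S, ← gramLeftInv_mul h, Matrix.mul_assoc, hS, Matrix.mul_zero]

omit [Fintype m] in
/-- If `Y V` has at least the rank of `Y`, its columns span the column space of `Y`. -/
theorem Matrix.exists_eq_mul_of_rank_le {Y : Matrix m n ℝ} {V : Matrix n k ℝ}
    (h : Y.rank ≤ (Y * V).rank) : ∃ W : Matrix k n ℝ, Y = Y * V * W := by
  classical
  have hle : LinearMap.range (Y * V).mulVecLin ≤ LinearMap.range Y.mulVecLin := by
    rw [Matrix.mulVecLin_mul]
    exact LinearMap.range_comp_le_range _ _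
  have heq := Submodule.eq_of_le_of_finrank_le hle h
  have hcol : ∀ j, ∃ w, (Y * V) *ᵥ w = Y.col j := by
    intro j
    have : Y.col j ∈ LinearMap.range (Y * V).mulVecLin := by
      rw [heq]
      exact ⟨Pi.single j 1, by simp⟩
    simpa using this
  choose w hw using hcol
  refine ⟨Matrix.of fun i j => w j i, ?_⟩
  ext i j
  have := congrFun (hw j) i
  simp only [Matrix.col_apply] at this
  rw [← this]
  rfl

/-- Skeleton decomposition: if `U Y V` is invertible of size `rank Y`, then
`Y = (Y V) (U Y V)⁻¹ (U Y)`. -/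
theorem Matrix.eq_mul_inv_mul_of_isUnit [DecidableEq k] {Y : Matrix m n ℝ} {U : Matrix k m ℝ}
    {V : Matrix n k ℝ} (hY : Y.rank ≤ Fintype.card k) (hU : IsUnit (U * Y * V)) :
    Y * V * (U * Y * V)⁻¹ * (U * Y) = Y := by
  have h1 : Y.rank ≤ (Y * V).rank := by
    refine hY.trans ?_
    rw [← Matrix.rank_of_isUnit _ hU, Matrix.mul_assoc]
    exact Matrix.rank_mul_le_right _ _
  obtain ⟨W, hW⟩ := exists_eq_mul_of_rank_le h1
  have h2 : U * Y = U * Y * V * W := by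
    conv_lhs => rw [hW]
    simp only [Matrix.mul_assoc]
  have h3 := (Matrix.isUnit_iff_isUnit_det _).1 hU
  have h4 : (U * Y * V)⁻¹ * (U * Y) = W := by
    generalize U * Y * V = C at h2 h3
    rw [h2, ← Matrix.mul_assoc, Matrix.nonsing_inv_mul _ h3, Matrix.one_mul]
  rw [Matrix.mul_assoc, h4, ← hW]

theorem Matrix.inner_eq_trace (A B : Matrix m n ℝ) : ⟪A, B⟫_ℝ = (Aᵀ * B).trace := rfl

theorem Matrix.inner_mul_left_eq (A : Matrix m k ℝ) (B : Matrix k n ℝ) (C : Matrix m n ℝ) :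
    ⟪A * B, C⟫_ℝ = ⟪B, Aᵀ * C⟫_ℝ := by
  simp only [inner_eq_trace, Matrix.transpose_mul, Matrix.mul_assoc]

theorem Matrix.inner_mul_right_eq (A : Matrix m k ℝ) (B : Matrix k n ℝ) (C : Matrix m n ℝ) :
    ⟪A * B, C⟫_ℝ = ⟪A, C * Bᵀ⟫_ℝ := by
  simp only [inner_eq_trace, Matrix.transpose_mul]
  rw [Matrix.mul_assoc, Matrix.trace_mul_comm, Matrix.mul_assoc]

theorem Matrix.inner_transpose_transpose (A B : Matrix m n ℝ) : ⟪Aᵀ, Bᵀ⟫_ℝ = ⟪A, B⟫_ℝ := by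
  rw [inner_eq_trace, inner_eq_trace, ← Matrix.trace_transpose, Matrix.transpose_mul,
    Matrix.transpose_transpose, Matrix.transpose_transpose, Matrix.trace_mul_comm]

theorem Matrix.inner_self_gram_mul (L : Matrix m n ℝ) (S : Matrix n k ℝ) :
    ⟪S, Lᵀ * L * S⟫_ℝ = ‖L * S‖ ^ 2 := by
  rw [← real_inner_self_eq_norm_sq, inner_mul_left_eq, Matrix.mul_assoc]

theorem Matrix.inner_self_mul_gram (L : Matrix m n ℝ) (S : Matrix k n ℝ) :
    ⟪S, S * (Lᵀ * L)⟫_ℝ = ‖L * Sᵀ‖ ^ 2 := by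
  rw [← inner_transpose_transpose, ← inner_self_gram_mul]
  simp only [Matrix.transpose_mul, Matrix.transpose_transpose]

/-- The Lyapunov equation `S M + M S = D` with `M = LᵀL` positive definite is solvable. -/
theorem Matrix.exists_lyapunov {L : Matrix m n ℝ} (h : Fintype.card n ≤ L.rank)
    (D : Matrix n n ℝ) : ∃ S : Matrix n n ℝ, S * (Lᵀ * L) + Lᵀ * L * S = D := by
  let T : Matrix n n ℝ →ₗ[ℝ] Matrix n n ℝ :=
    { toFun := fun S => S * (Lᵀ * L) + Lᵀ * L * S
      map_add' := fun S S' => by rw [Matrix.add_mul, Matrix.mul_add]; abel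
      map_smul' := fun c S => by
        rw [Matrix.smul_mul, Matrix.mul_smul, RingHom.id_apply, smul_add] }
  have hT : Function.Injective T := by
    rw [← LinearMap.ker_eq_bot, LinearMap.ker_eq_bot']
    intro S hS
    have h0 : ⟪S, S * (Lᵀ * L) + Lᵀ * L * S⟫_ℝ = 0 := by
      rw [show S * (Lᵀ * L) + Lᵀ * L * S = 0 from hS, inner_zero_right]
    rw [inner_add_right, inner_self_mul_gram, inner_self_gram_mul] at h0
    have h1 : ‖L * S‖ ^ 2 = 0 := by nlinarith [sq_nonneg ‖L * S‖, sq_nonneg ‖L * Sᵀ‖]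
    exact eq_zero_of_mul_eq_zero_of_card_le_rank h
      (norm_eq_zero.1 ((pow_eq_zero_iff two_ne_zero).1 h1))
  exact LinearMap.surjective_of_injective hT D

end LinearAlgebra

/-! ### Calculus of matrix-valued maps -/

section Calculus

variable {m n k : Type*} [Fintype m] [Fintype n] [Fintype k]
variable {E : Type*} [NormedAddCommGroup E] [NormedSpace ℝ E]

/-- Matrix multiplication as a continuous bilinear map for the Frobenius norms. -/
noncomputable def Matrix.mulCLM (m n k : Type*) [Fintype m] [Fintype n] [Fintype k] :
    Matrix m n ℝ →L[ℝ] Matrix n k ℝ →L[ℝ] Matrix m k ℝ :=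
  LinearMap.mkContinuous₂
    (LinearMap.mk₂ ℝ (fun A B => A * B) Matrix.add_mul (fun c A B => Matrix.smul_mul c A B)
      Matrix.mul_add (fun c A B => Matrix.mul_smul A c B)) 1
    (fun A B => by simpa using Matrix.frobenius_norm_mul A B)

/-- Transposition as a continuous linear map. -/
noncomputable def Matrix.transposeCLM (m n : Type*) [Fintype m] [Fintype n] :
    Matrix m n ℝ →L[ℝ] Matrix n m ℝ :=
  LinearMap.toContinuousLinearMap (Matrix.transposeLinearEquiv m n ℝ ℝ).toLinearMap

@[fun_prop]
theorem DifferentiableAt.matrix_mul {a : E → Matrix m n ℝ} {b : E → Matrix n k ℝ} {x : E}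
    (ha : DifferentiableAt ℝ a x) (hb : DifferentiableAt ℝ b x) :
    DifferentiableAt ℝ (fun y => a y * b y) x :=
  ((Matrix.mulCLM m n k).hasFDerivAt_of_bilinear ha.hasFDerivAt hb.hasFDerivAt).differentiableAt

@[fun_prop]
theorem DifferentiableAt.matrix_transpose {a : E → Matrix m n ℝ} {x : E}
    (ha : DifferentiableAt ℝ a x) : DifferentiableAt ℝ (fun y => (a y)ᵀ) x :=
  (Matrix.transposeCLM m n).differentiableAt.comp x ha

theorem DifferentiableAt.matrix_inv [DecidableEq n] {a : E → Matrix n n ℝ} {x : E}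
    (ha : DifferentiableAt ℝ a x) (hx : IsUnit (a x)) :
    DifferentiableAt ℝ (fun y => (a y)⁻¹) x := by
  let _ : NormedRing (Matrix n n ℝ) := Matrix.frobeniusNormedRing
  let _ : NormedAlgebra ℝ (Matrix n n ℝ) := Matrix.frobeniusNormedAlgebra
  have : CompleteSpace (Matrix n n ℝ) := FiniteDimensional.complete ℝ _
  have h : DifferentiableAt ℝ (Ring.inverse : Matrix n n ℝ → Matrix n n ℝ) (a x) :=
    differentiableAt_inverse hx
  have h2 := h.comp x ha
  refine h2.congr_of_eventuallyEq (Filter.Eventually.of_forall fun y => ?_)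
  exact Matrix.nonsing_inv_eq_ringInverse _

@[fun_prop]
theorem ContDiff.matrix_mul {N : ℕ∞ω} {a : E → Matrix m n ℝ} {b : E → Matrix n k ℝ}
    (ha : ContDiff ℝ N a) (hb : ContDiff ℝ N b) : ContDiff ℝ N (fun y => a y * b y) :=
  (Matrix.mulCLM m n k).isBoundedBilinearMap.contDiff.comp (ha.prodMk hb)

@[fun_prop]
theorem ContDiff.matrix_transpose {N : ℕ∞ω} {a : E → Matrix m n ℝ} (ha : ContDiff ℝ N a) :
    ContDiff ℝ N (fun y => (a y)ᵀ) :=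
  (Matrix.transposeCLM m n).contDiff.comp ha

theorem HasDerivAt.matrix_mul {a : ℝ → Matrix m n ℝ} {b : ℝ → Matrix n k ℝ} {a' : Matrix m n ℝ}
    {b' : Matrix n k ℝ} {t : ℝ} (ha : HasDerivAt a a' t) (hb : HasDerivAt b b' t) :
    HasDerivAt (fun s => a s * b s) (a' * b t + a t * b') t := by
  have h := (Matrix.mulCLM m n k).hasDerivAt_of_bilinear (x := t) (fun _ => ha) (fun _ => hb)
  exact h.congr_deriv (add_comm _ _)

theorem HasDerivAt.matrix_transpose {a : ℝ → Matrix m n ℝ} {a' : Matrix m n ℝ} {t : ℝ}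
    (ha : HasDerivAt a a' t) : HasDerivAt (fun s => (a s)ᵀ) a'ᵀ t :=
  (Matrix.transposeCLM m n).hasFDerivAt.comp_hasDerivAt t ha

theorem eventually_isUnit_matrix [DecidableEq n] {α : Type*} [TopologicalSpace α]
    {a : α → Matrix n n ℝ} {x : α} (ha : ContinuousAt a x) (hx : IsUnit (a x)) :
    ∀ᶠ y in nhds x, IsUnit (a y) := by
  have h : ContinuousAt (fun y => (a y).det) x :=
    (continuous_id.matrix_det (n := n) (R := ℝ)).continuousAt.comp ha
  have h0 : (a x).det ≠ 0 := ((Matrix.isUnit_iff_isUnit_det _).1 hx).ne_zero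
  filter_upwards [h.eventually_ne h0] with y hy
  exact (Matrix.isUnit_iff_isUnit_det _).2 (isUnit_iff_ne_zero.2 hy)

end Calculus

/-! ### Stationarity as derivatives along curves -/

section Stationarity

variable {E : Type*} [NormedAddCommGroup E] [InnerProductSpace ℝ E]

theorem inner_gradient_eq_fderiv [CompleteSpace E] (h : E → ℝ) (x z : E) :
    ⟪∇ h x, z⟫_ℝ = fderiv ℝ h x z := by
  simp [gradient]

theorem isEuclideanFOSP_iff [CompleteSpace E] {h : E → ℝ} {x : E} :
    IsEuclideanFOSP h x ↔ ∀ z, ⟪∇ h x, z⟫_ℝ = 0 :=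
  ⟨fun hx z => by rw [show ∇ h x = 0 from hx, inner_zero_left],
    fun hx => inner_self_eq_zero.1 (hx _)⟩

theorem differentiable_gradient [CompleteSpace E] {h : E → ℝ} (hh : ContDiff ℝ 2 h) :
    Differentiable ℝ fun y => ∇ h y :=
  (InnerProductSpace.toDual ℝ E).symm.toContinuousLinearEquiv.differentiable.comp
    ((hh.fderiv_right (m := 1) le_rfl).differentiable one_ne_zero)

theorem hasDerivAt_line (x z : E) (t : ℝ) : HasDerivAt (fun s : ℝ => x + s • z) z t := by
  simpa using ((hasDerivAt_id t).smul_const z).const_add x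

/-- The Euclidean Hessian form is the second derivative along lines. -/
theorem hasDerivAt_inner_gradient_line [CompleteSpace E] {h : E → ℝ} (hh : ContDiff ℝ 2 h)
    (x z : E) :
    HasDerivAt (fun t : ℝ => ⟪∇ h (x + t • z), z⟫_ℝ) ⟪euclideanHessian h x z, z⟫_ℝ 0 := by
  have h1 := (differentiable_gradient hh (x + (0 : ℝ) • z)).hasFDerivAt.comp_hasDerivAt (0 : ℝ)
    (hasDerivAt_line x z 0)
  have h2 := h1.inner ℝ (hasDerivAt_const (0 : ℝ) z)
  simp only [inner_zero_right, zero_add, zero_smul, add_zero] at h2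
  exact h2

theorem hasDerivAt_comp_curve [CompleteSpace E] {h : E → ℝ} (hh : ContDiff ℝ 2 h) {γ : ℝ → E}
    {Z : E} {t : ℝ} (hγ : HasDerivAt γ Z t) :
    HasDerivAt (fun s => h (γ s)) ⟪∇ h (γ t), Z⟫_ℝ t := by
  rw [inner_gradient_eq_fderiv]
  exact (hh.differentiable two_ne_zero _).hasFDerivAt.comp_hasDerivAt t hγ

variable [FiniteDimensional ℝ E]

theorem isRiemannianFOSP_iff {M : Set E} {f : E → ℝ} {X : E} :
    IsRiemannianFOSP M f X ↔ X ∈ M ∧ ∀ Z ∈ tangentSpaceOf M X, ⟪∇ f X, Z⟫_ℝ = 0 := by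
  simp only [inner_gradient_eq_fderiv]
  refine and_congr_right fun _ => ⟨fun h Z hZ => ?_, fun h => ?_⟩
  · rw [← inner_riemannianGradient M f X ⟨Z, hZ⟩, h, inner_zero_left]
  · refine ext_inner_right ℝ fun Z => ?_
    rw [inner_riemannianGradient, inner_zero_left]
    exact h Z Z.2

theorem inner_riemannianGradientField {M : Set E} {f : E → ℝ} {X Z : E}
    (hZ : Z ∈ tangentSpaceOf M X) :
    ⟪riemannianGradientField M f X, Z⟫_ℝ = ⟪∇ f X, Z⟫_ℝ := by
  rw [inner_gradient_eq_fderiv]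
  exact inner_riemannianGradient M f X ⟨Z, hZ⟩

theorem riemannianGradientField_eq {M : Set E} {f : E → ℝ} {X G : E}
    (hG : G ∈ tangentSpaceOf M X) (h : ∀ Z ∈ tangentSpaceOf M X, ⟪G, Z⟫_ℝ = ⟪∇ f X, Z⟫_ℝ) :
    riemannianGradientField M f X = G := by
  have : riemannianGradient M f X = ⟨G, hG⟩ := by
    refine ext_inner_right ℝ fun Z => ?_
    rw [inner_riemannianGradient, ← inner_gradient_eq_fderiv]
    exact (h Z Z.2).symm
  rw [riemannianGradientField, this]

/-- At a critical point the Riemannian Hessian form is the second derivative of `f` along any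
curve in `M`: differentiate `⟪grad f(γ), γ'⟫ = ⟪∇f(γ), γ'⟫`; the term with `γ''` is multiplied by
the vanishing gradient. -/
theorem hasDerivAt_inner_gradient_curve {M : Set E} {f : E → ℝ} {γ γ' : ℝ → E} {X Γ : E}
    {Z : tangentSpaceOf M X} (hX : γ 0 = X)
    (hγ : ∀ᶠ t in nhds (0 : ℝ), γ t ∈ M ∧ γ' t ∈ tangentSpaceOf M (γ t))
    (hd : HasDerivAt γ (Z : E) 0) (hZ : γ' 0 = Z) (hd' : HasDerivAt γ' Γ 0)
    (hgrad : riemannianGradient M f X = 0)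
    (hdiff : DifferentiableWithinAt ℝ (riemannianGradientField M f) M X) :
    HasDerivAt (fun t => ⟪∇ f (γ t), γ' t⟫_ℝ) ⟪riemannianHessian M f X Z, Z⟫_ℝ 0 := by
  subst hX
  have h1 := hdiff.hasFDerivWithinAt.comp_hasDerivWithinAt (0 : ℝ)
    (hd.hasDerivWithinAt (s := γ ⁻¹' M)) (Set.mapsTo_preimage γ M)
  have h2 := (h1.hasDerivAt (hγ.mono fun t ht => ht.1)).inner ℝ hd'
  have h3 : riemannianGradientField M f (γ 0) = 0 := by
    rw [riemannianGradientField, hgrad, Submodule.coe_zero]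
  have h4 : ⟪riemannianHessian M f (γ 0) Z, Z⟫_ℝ =
      ⟪(riemannianGradientField M f ∘ γ) 0, Γ⟫_ℝ +
        ⟪fderivWithin ℝ (riemannianGradientField M f) M (γ 0) Z, γ' 0⟫_ℝ := by
    rw [Function.comp_apply, h3, inner_zero_left, zero_add, hZ, riemannianHessian,
      riemannianConnection, ContinuousLinearMap.comp_apply]
    exact Submodule.inner_orthogonalProjectionOnto_eq_of_mem_right _ _
  rw [h4]
  refine h2.congr_of_eventuallyEq (hγ.mono fun t ht => ?_)
  exact (inner_riemannianGradientField ht.2).symm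

end Stationarity

/-! ### The factorization map and the tangent spaces of the fixed-rank manifold -/

section FixedRank

variable {p₁ p₂ r : ℕ}

/-- The factorization map `(L, R) ↦ L Rᵀ`. -/
def factorProduct (w : FactorSpace p₁ p₂ r) : Matrix (Fin p₁) (Fin p₂) ℝ :=
  w.fst * w.sndᵀ

/-- The differential `(A, B) ↦ A Rᵀ + L Bᵀ` at `w = (L, R)` of the factorization map. -/
def factorTangent (w : FactorSpace p₁ p₂ r) :
    FactorSpace p₁ p₂ r →ₗ[ℝ] Matrix (Fin p₁) (Fin p₂) ℝ where
  toFun z := z.fst * w.sndᵀ + w.fst * z.sndᵀ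
  map_add' z z' := by
    rw [WithLp.add_fst, WithLp.add_snd, Matrix.transpose_add, Matrix.add_mul, Matrix.mul_add]
    abel
  map_smul' c z := by
    rw [WithLp.smul_fst, WithLp.smul_snd, Matrix.transpose_smul, Matrix.smul_mul, Matrix.mul_smul,
      RingHom.id_apply, smul_add]

theorem factorTangent_apply (w z : FactorSpace p₁ p₂ r) :
    factorTangent w z = z.fst * w.sndᵀ + w.fst * z.sndᵀ := rfl

@[fun_prop]
theorem contDiff_withLp_fst {N : ℕ∞ω} : ContDiff ℝ N fun w : FactorSpace p₁ p₂ r => w.fst :=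
  (WithLp.fstL 2 ℝ (Matrix (Fin p₁) (Fin r) ℝ) (Matrix (Fin p₂) (Fin r) ℝ)).contDiff

@[fun_prop]
theorem contDiff_withLp_snd {N : ℕ∞ω} : ContDiff ℝ N fun w : FactorSpace p₁ p₂ r => w.snd :=
  (WithLp.sndL 2 ℝ (Matrix (Fin p₁) (Fin r) ℝ) (Matrix (Fin p₂) (Fin r) ℝ)).contDiff

theorem contDiff_factorProduct {N : ℕ∞ω} :
    ContDiff ℝ N (factorProduct : FactorSpace p₁ p₂ r → _) := by
  unfold factorProduct
  fun_prop

theorem hasDerivAt_fst_line (w z : FactorSpace p₁ p₂ r) (t : ℝ) :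
    HasDerivAt (fun s : ℝ => (w + s • z).fst) z.fst t :=
  hasDerivAt_line w.fst z.fst t

theorem hasDerivAt_snd_line (w z : FactorSpace p₁ p₂ r) (t : ℝ) :
    HasDerivAt (fun s : ℝ => (w + s • z).snd) z.snd t :=
  hasDerivAt_line w.snd z.snd t

theorem hasDerivAt_factorProduct_line (w z : FactorSpace p₁ p₂ r) (t : ℝ) :
    HasDerivAt (fun s : ℝ => factorProduct (w + s • z)) (factorTangent (w + t • z) z) t :=
  (hasDerivAt_fst_line w z t).matrix_mul (hasDerivAt_snd_line w z t).matrix_transpose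

theorem hasDerivAt_factorTangent_line (w z : FactorSpace p₁ p₂ r) (t : ℝ) :
    HasDerivAt (fun s : ℝ => factorTangent (w + s • z) z) (factorTangent z z) t := by
  have h1 := (hasDerivAt_const t z.fst).matrix_mul (hasDerivAt_snd_line w z t).matrix_transpose
  have h2 := (hasDerivAt_fst_line w z t).matrix_mul (hasDerivAt_const t z.sndᵀ)
  refine (h1.add h2).congr_deriv ?_
  rw [Matrix.zero_mul, Matrix.mul_zero, zero_add, add_zero]
  rfl

theorem le_rank_fst {w : FactorSpace p₁ p₂ r} (hw : (factorProduct w).rank = r) :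
    Fintype.card (Fin r) ≤ w.fst.rank := by
  rw [Fintype.card_fin]
  exact hw.symm.le.trans (Matrix.rank_mul_le_left _ _)

theorem le_rank_snd {w : FactorSpace p₁ p₂ r} (hw : (factorProduct w).rank = r) :
    Fintype.card (Fin r) ≤ w.snd.rank := by
  rw [Fintype.card_fin, ← Matrix.rank_transpose]
  exact hw.symm.le.trans (Matrix.rank_mul_le_right _ _)

theorem gramLeftInv_mul_factorProduct_mul {w : FactorSpace p₁ p₂ r}
    (hw : (factorProduct w).rank = r) :
    w.fst.gramLeftInv * factorProduct w * w.snd.gramLeftInvᵀ = 1 := by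
  rw [factorProduct, ← Matrix.mul_assoc, Matrix.gramLeftInv_mul (le_rank_fst hw), Matrix.one_mul,
    ← Matrix.transpose_mul, Matrix.gramLeftInv_mul (le_rank_snd hw), Matrix.transpose_one]

theorem eventually_isUnit_core {w : FactorSpace p₁ p₂ r} (hw : (factorProduct w).rank = r) :
    ∀ᶠ Y in nhds (factorProduct w), IsUnit (w.fst.gramLeftInv * Y * w.snd.gramLeftInvᵀ) := by
  refine eventually_isUnit_matrix (Continuous.continuousAt (by fun_prop)) ?_
  rw [gramLeftInv_mul_factorProduct_mul hw]
  exact isUnit_one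

/-- The products stay of rank `r` along lines in the space of factors. -/
theorem eventually_rank_factorProduct_line {w : FactorSpace p₁ p₂ r}
    (hw : (factorProduct w).rank = r) (z : FactorSpace p₁ p₂ r) :
    ∀ᶠ t in nhds (0 : ℝ), (factorProduct (w + t • z)).rank = r := by
  have h1 := (hasDerivAt_factorProduct_line w z 0).continuousAt
  have h2 : ∀ᶠ Y in nhds (factorProduct (w + (0 : ℝ) • z)),
      IsUnit (w.fst.gramLeftInv * Y * w.snd.gramLeftInvᵀ) := by
    rw [zero_smul, add_zero]
    exact eventually_isUnit_core hw
  filter_upwards [h1.eventually h2] with t ht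
  refine le_antisymm ((Matrix.rank_mul_le_left _ _).trans (Matrix.rank_le_width _)) ?_
  have h3 := Matrix.rank_of_isUnit _ ht
  rw [Fintype.card_fin] at h3
  exact h3.symm.le.trans ((Matrix.rank_mul_le_left _ _).trans (Matrix.rank_mul_le_right _ _))

/-- Near `X = L Rᵀ` the factorization map has a differentiable section along the matrices of
rank `r`, given by the skeleton decomposition. -/
theorem exists_factor_section {w : FactorSpace p₁ p₂ r} (hw : (factorProduct w).rank = r) :
    ∃ (a : Matrix (Fin p₁) (Fin p₂) ℝ → Matrix (Fin p₁) (Fin r) ℝ)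
      (b : Matrix (Fin p₁) (Fin p₂) ℝ → Matrix (Fin p₂) (Fin r) ℝ),
      DifferentiableAt ℝ a (factorProduct w) ∧ DifferentiableAt ℝ b (factorProduct w) ∧
      a (factorProduct w) = w.fst ∧ b (factorProduct w) = w.snd ∧
      ∀ᶠ Y in nhds (factorProduct w), Y.rank = r → a Y * (b Y)ᵀ = Y := by
  set U := w.fst.gramLeftInv with hU
  set V := w.snd.gramLeftInvᵀ with hV
  have hC : U * factorProduct w * V = 1 := gramLeftInv_mul_factorProduct_mul hw
  refine ⟨fun Y => Y * V * (U * Y * V)⁻¹, fun Y => (U * Y)ᵀ, ?_, by fun_prop, ?_, ?_, ?_⟩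
  · refine DifferentiableAt.matrix_mul (by fun_prop) ?_
    refine DifferentiableAt.matrix_inv (by fun_prop) ?_
    rw [hC]
    exact isUnit_one
  · simp only [hC]
    rw [inv_one, Matrix.mul_one, factorProduct, Matrix.mul_assoc, hV, ← Matrix.transpose_mul,
      Matrix.gramLeftInv_mul (le_rank_snd hw), Matrix.transpose_one, Matrix.mul_one]
  · simp only
    rw [factorProduct, ← Matrix.mul_assoc, hU, Matrix.gramLeftInv_mul (le_rank_fst hw),
      Matrix.one_mul, Matrix.transpose_transpose]
  · filter_upwards [eventually_isUnit_core hw] with Y hY hr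
    rw [Matrix.transpose_transpose]
    exact Matrix.eq_mul_inv_mul_of_isUnit (by rw [hr, Fintype.card_fin]) hY

theorem factorTangent_mem_curveVelocities {w : FactorSpace p₁ p₂ r}
    (hw : (factorProduct w).rank = r) (z : FactorSpace p₁ p₂ r) :
    factorTangent w z ∈ curveVelocities (fixedRankManifold p₁ p₂ r) (factorProduct w) := by
  obtain ⟨ε, hε, h⟩ := Metric.eventually_nhds_iff.1 (eventually_rank_factorProduct_line hw z)
  refine ⟨fun t => factorProduct (w + t • z), ε, hε, ?_, fun t ht => h ?_, ?_, ?_⟩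
  · exact (contDiff_factorProduct.comp (by fun_prop)).contDiffOn
  · rw [Real.dist_eq, sub_zero]
    exact abs_lt.2 ht
  · simp
  · have h1 := hasDerivAt_factorProduct_line w z 0
    rw [zero_smul, add_zero] at h1
    exact h1

/-- The tangent space at `L Rᵀ` consists of the matrices `A Rᵀ + L Bᵀ`. -/
theorem tangentSpaceOf_fixedRankManifold {w : FactorSpace p₁ p₂ r}
    (hw : (factorProduct w).rank = r) :
    tangentSpaceOf (fixedRankManifold p₁ p₂ r) (factorProduct w) =
      LinearMap.range (factorTangent w) := by
  refine le_antisymm (Submodule.span_le.2 ?_) ?_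
  · rintro Z ⟨γ, ε, hε, -, hM, h0, hd⟩
    obtain ⟨a, b, ha, hb, haw, hbw, hab⟩ := exists_factor_section hw
    rw [← h0] at ha hb haw hbw hab
    have h1 : HasDerivAt (fun t => a (γ t)) _ 0 := ha.hasFDerivAt.comp_hasDerivAt 0 hd
    have h2 : HasDerivAt (fun t => b (γ t)) _ 0 := hb.hasFDerivAt.comp_hasDerivAt 0 hd
    have h3 := h1.matrix_mul h2.matrix_transpose
    have h4 : (fun t => a (γ t) * (b (γ t))ᵀ) =ᶠ[nhds 0] γ := by
      filter_upwards [hd.continuousAt.eventually hab, Ioo_mem_nhds (neg_lt_zero.2 hε) hε]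
        with t ht ht'
      exact ht (hM t ht')
    have h5 := hd.unique (h3.congr_of_eventuallyEq h4.symm)
    rw [haw, hbw] at h5
    exact ⟨WithLp.toLp 2 (_, _), h5.symm⟩
  · rintro _ ⟨z, rfl⟩
    exact Submodule.subset_span (factorTangent_mem_curveVelocities hw z)

theorem isRiemannianFOSP_fixedRankManifold_iff {f : Matrix (Fin p₁) (Fin p₂) ℝ → ℝ}
    {w : FactorSpace p₁ p₂ r} (hw : (factorProduct w).rank = r) :
    IsRiemannianFOSP (fixedRankManifold p₁ p₂ r) f (factorProduct w) ↔
      ∀ z, ⟪∇ f (factorProduct w), factorTangent w z⟫_ℝ = 0 := by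
  rw [isRiemannianFOSP_iff, tangentSpaceOf_fixedRankManifold hw]
  refine ⟨fun h z => h.2 _ ⟨z, rfl⟩, fun h => ⟨hw, ?_⟩⟩
  rintro _ ⟨z, rfl⟩
  exact h z

/-! ### Differentiability of the Riemannian gradient field -/

/-- The Riemannian gradient at `L Rᵀ` is `W - (1 - L L⁺) W (1 - R R⁺)ᵀ` with `W = ∇f(L Rᵀ)`: the
subtracted term is the normal component. -/
theorem riemannianGradientField_fixedRankManifold {f : Matrix (Fin p₁) (Fin p₂) ℝ → ℝ}
    {w : FactorSpace p₁ p₂ r} (hw : (factorProduct w).rank = r) :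
    riemannianGradientField (fixedRankManifold p₁ p₂ r) f (factorProduct w) =
      ∇ f (factorProduct w) - (1 - w.fst * w.fst.gramLeftInv) * ∇ f (factorProduct w) *
        (1 - w.snd * w.snd.gramLeftInv)ᵀ := by
  set W := ∇ f (factorProduct w)
  refine riemannianGradientField_eq ?_ ?_
  · rw [tangentSpaceOf_fixedRankManifold hw]
    refine ⟨WithLp.toLp 2 ((1 - w.fst * w.fst.gramLeftInv) * W * w.snd.gramLeftInvᵀ,
      (w.fst.gramLeftInv * W)ᵀ), ?_⟩
    change (1 - w.fst * w.fst.gramLeftInv) * W * w.snd.gramLeftInvᵀ * w.sndᵀ +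
      w.fst * (w.fst.gramLeftInv * W)ᵀᵀ = _
    simp only [Matrix.transpose_sub, Matrix.transpose_one,
      Matrix.transpose_mul, Matrix.mul_sub, Matrix.sub_mul, Matrix.mul_one, Matrix.one_mul,
      Matrix.transpose_transpose, Matrix.mul_assoc]
    abel
  · rw [tangentSpaceOf_fixedRankManifold hw]
    rintro _ ⟨z, rfl⟩
    have h1 : ⟪(1 - w.fst * w.fst.gramLeftInv) * W * (1 - w.snd * w.snd.gramLeftInv)ᵀ,
        factorTangent w z⟫_ℝ = 0 := by
      have hR : w.sndᵀ * (1 - w.snd * w.snd.gramLeftInv) = 0 :=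
        Matrix.transpose_mul_one_sub_gramLeftInv (le_rank_snd hw)
      have hL : (1 - w.fst * w.fst.gramLeftInv)ᵀ * w.fst = 0 := by
        rw [← Matrix.transpose_inj, Matrix.transpose_mul, Matrix.transpose_transpose,
          Matrix.transpose_zero]
        exact Matrix.transpose_mul_one_sub_gramLeftInv (le_rank_fst hw)
      rw [factorTangent_apply, inner_add_right, Matrix.inner_mul_right_eq,
        Matrix.transpose_transpose, Matrix.mul_assoc z.fst, hR, Matrix.mul_zero,
        inner_zero_right, Matrix.mul_assoc (1 - w.fst * w.fst.gramLeftInv),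
        Matrix.inner_mul_left_eq, ← Matrix.mul_assoc _ w.fst, hL, Matrix.zero_mul,
        inner_zero_right, add_zero]
    rw [inner_sub_left, h1, sub_zero]

theorem differentiableWithinAt_riemannianGradientField {f : Matrix (Fin p₁) (Fin p₂) ℝ → ℝ}
    (hf : ContDiff ℝ 2 f) {w : FactorSpace p₁ p₂ r} (hw : (factorProduct w).rank = r) :
    DifferentiableWithinAt ℝ (riemannianGradientField (fixedRankManifold p₁ p₂ r) f)
      (fixedRankManifold p₁ p₂ r) (factorProduct w) := by
  obtain ⟨a, b, ha, hb, haw, hbw, hab⟩ := exists_factor_section hw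
  have hgrad : DifferentiableAt ℝ (fun Y => ∇ f Y) (factorProduct w) :=
    differentiable_gradient hf _
  have hainv : DifferentiableAt ℝ (fun Y => (a Y).gramLeftInv) (factorProduct w) := by
    refine DifferentiableAt.matrix_mul (DifferentiableAt.matrix_inv (by fun_prop) ?_) (by fun_prop)
    rw [haw]
    exact Matrix.isUnit_gram (le_rank_fst hw)
  have hbinv : DifferentiableAt ℝ (fun Y => (b Y).gramLeftInv) (factorProduct w) := by
    refine DifferentiableAt.matrix_mul (DifferentiableAt.matrix_inv (by fun_prop) ?_) (by fun_prop)
    rw [hbw]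
    exact Matrix.isUnit_gram (le_rank_snd hw)
  have key : DifferentiableAt ℝ (fun Y => ∇ f Y - (1 - a Y * (a Y).gramLeftInv) * ∇ f Y *
      (1 - b Y * (b Y).gramLeftInv)ᵀ) (factorProduct w) := by
    refine hgrad.sub (DifferentiableAt.matrix_mul (DifferentiableAt.matrix_mul ?_ hgrad) ?_)
    · exact (differentiableAt_const _).sub (ha.matrix_mul hainv)
    · exact ((differentiableAt_const _).sub (hb.matrix_mul hbinv)).matrix_transpose
  have hev : ∀ᶠ Y in nhds (factorProduct w), Y ∈ fixedRankManifold p₁ p₂ r →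
      riemannianGradientField (fixedRankManifold p₁ p₂ r) f Y =
        ∇ f Y - (1 - a Y * (a Y).gramLeftInv) * ∇ f Y * (1 - b Y * (b Y).gramLeftInv)ᵀ := by
    filter_upwards [hab] with Y hY hr
    have h : factorProduct (WithLp.toLp 2 (a Y, b Y) : FactorSpace p₁ p₂ r) = Y := hY hr
    have h2 := riemannianGradientField_fixedRankManifold (f := f)
      (w := (WithLp.toLp 2 (a Y, b Y) : FactorSpace p₁ p₂ r)) (by rw [h]; exact hr)
    rw [h] at h2
    exact h2
  exact key.differentiableWithinAt.congr_of_eventuallyEq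
    (eventually_nhdsWithin_iff.2 hev) (hev.self_of_nhds hw)

end FixedRank

/-! ### The factorized objective -/

section Objectives

variable {p₁ p₂ r : ℕ} {f : Matrix (Fin p₁) (Fin p₂) ℝ → ℝ}

theorem contDiff_factorObjective (hf : ContDiff ℝ 2 f) : ContDiff ℝ 2 (factorObjective r f) :=
  hf.comp contDiff_factorProduct

theorem inner_gradient_factorObjective (hf : ContDiff ℝ 2 f) (w z : FactorSpace p₁ p₂ r) :
    ⟪∇ (factorObjective r f) w, z⟫_ℝ = ⟪∇ f (factorProduct w), factorTangent w z⟫_ℝ := by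
  have h1 := hasDerivAt_comp_curve (contDiff_factorObjective (r := r) hf) (hasDerivAt_line w z 0)
  have h2 := hasDerivAt_comp_curve hf (hasDerivAt_factorProduct_line w z 0)
  have h3 := h1.unique h2
  rwa [zero_smul, add_zero] at h3

theorem isRiemannianFOSP_iff_isEuclideanFOSP (hf : ContDiff ℝ 2 f) {w : FactorSpace p₁ p₂ r}
    (hw : (factorProduct w).rank = r) :
    IsRiemannianFOSP (fixedRankManifold p₁ p₂ r) f (factorProduct w) ↔
      IsEuclideanFOSP (factorObjective r f) w := by
  rw [isRiemannianFOSP_fixedRankManifold_iff hw, isEuclideanFOSP_iff]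
  simp only [inner_gradient_factorObjective hf]

/-- At a critical point the Hessian form of `g` is the pull-back of the Riemannian Hessian form of
`f` by the differential of the factorization map. -/
theorem inner_euclideanHessian_factorObjective (hf : ContDiff ℝ 2 f) {w : FactorSpace p₁ p₂ r}
    (hw : (factorProduct w).rank = r)
    (hgrad : riemannianGradient (fixedRankManifold p₁ p₂ r) f (factorProduct w) = 0)
    {Z : tangentSpaceOf (fixedRankManifold p₁ p₂ r) (factorProduct w)}
    {z : FactorSpace p₁ p₂ r} (hZ : factorTangent w z = Z) :
    ⟪euclideanHessian (factorObjective r f) w z, z⟫_ℝ =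
      ⟪riemannianHessian (fixedRankManifold p₁ p₂ r) f (factorProduct w) Z, Z⟫_ℝ := by
  have h1 := hasDerivAt_inner_gradient_line (contDiff_factorObjective (r := r) hf) w z
  simp only [inner_gradient_factorObjective hf] at h1
  have h0 : w + (0 : ℝ) • z = w := by rw [zero_smul, add_zero]
  have hd := hasDerivAt_factorProduct_line w z 0
  rw [h0, hZ] at hd
  refine h1.unique (hasDerivAt_inner_gradient_curve (γ := fun t => factorProduct (w + t • z))
    (γ' := fun t => factorTangent (w + t • z) z) (by rw [h0]) ?_ hd (by rw [h0, hZ])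
    (hasDerivAt_factorTangent_line w z 0) hgrad
    (differentiableWithinAt_riemannianGradientField hf hw))
  filter_upwards [eventually_rank_factorProduct_line hw z] with t ht
  refine ⟨ht, ?_⟩
  rw [tangentSpaceOf_fixedRankManifold ht]
  exact ⟨z, rfl⟩

theorem isRiemannianSOSP_iff_isEuclideanSOSP (hf : ContDiff ℝ 2 f) {w : FactorSpace p₁ p₂ r}
    (hw : (factorProduct w).rank = r) :
    IsRiemannianSOSP (fixedRankManifold p₁ p₂ r) f (factorProduct w) ↔
      IsEuclideanSOSP (factorObjective r f) w := by
  constructor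
  · rintro ⟨hM, hgrad, -, hH⟩
    refine ⟨(isRiemannianFOSP_iff_isEuclideanFOSP hf hw).1 ⟨hM, hgrad⟩, fun z => ?_⟩
    have hz : factorTangent w z ∈
        tangentSpaceOf (fixedRankManifold p₁ p₂ r) (factorProduct w) := by
      rw [tangentSpaceOf_fixedRankManifold hw]
      exact ⟨z, rfl⟩
    rw [inner_euclideanHessian_factorObjective hf hw hgrad (Z := ⟨_, hz⟩) rfl]
    exact hH _
  · rintro ⟨hg, hH⟩
    obtain ⟨hM, hgrad⟩ := (isRiemannianFOSP_iff_isEuclideanFOSP hf hw).2 hg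
    refine ⟨hM, hgrad, differentiableWithinAt_riemannianGradientField hf hw, fun Z => ?_⟩
    have hZ : (Z : Matrix (Fin p₁) (Fin p₂) ℝ) ∈ LinearMap.range (factorTangent w) := by
      rw [← tangentSpaceOf_fixedRankManifold hw]
      exact Z.2
    obtain ⟨z, hz⟩ := hZ
    rw [← inner_euclideanHessian_factorObjective hf hw hgrad hz]
    exact hH z

/-! ### The balancing regularizer -/

/-- The imbalance `LᵀL - RᵀR` of a pair of factors. -/
def factorImbalance (w : FactorSpace p₁ p₂ r) : Matrix (Fin r) (Fin r) ℝ :=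
  w.fstᵀ * w.fst - w.sndᵀ * w.snd

/-- The directional derivative at `w` along `z` of the imbalance. -/
def factorImbalanceDeriv (w z : FactorSpace p₁ p₂ r) : Matrix (Fin r) (Fin r) ℝ :=
  z.fstᵀ * w.fst + w.fstᵀ * z.fst - (z.sndᵀ * w.snd + w.sndᵀ * z.snd)

theorem transpose_factorImbalance (w : FactorSpace p₁ p₂ r) :
    (factorImbalance w)ᵀ = factorImbalance w := by
  simp [factorImbalance, Matrix.transpose_mul]

theorem transpose_factorImbalanceDeriv (w z : FactorSpace p₁ p₂ r) :
    (factorImbalanceDeriv w z)ᵀ = factorImbalanceDeriv w z := by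
  simp only [factorImbalanceDeriv, Matrix.transpose_sub, Matrix.transpose_add,
    Matrix.transpose_mul, Matrix.transpose_transpose]
  abel

theorem contDiff_factorImbalance :
    ContDiff ℝ 2 (factorImbalance : FactorSpace p₁ p₂ r → _) := by
  unfold factorImbalance
  exact ContDiff.sub (by fun_prop) (by fun_prop)

theorem hasDerivAt_factorImbalance_line (w z : FactorSpace p₁ p₂ r) (t : ℝ) :
    HasDerivAt (fun s : ℝ => factorImbalance (w + s • z)) (factorImbalanceDeriv (w + t • z) z) t :=
  ((hasDerivAt_fst_line w z t).matrix_transpose.matrix_mul (hasDerivAt_fst_line w z t)).sub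
    ((hasDerivAt_snd_line w z t).matrix_transpose.matrix_mul (hasDerivAt_snd_line w z t))

theorem hasDerivAt_factorImbalanceDeriv_line (w z : FactorSpace p₁ p₂ r) (t : ℝ) :
    ∃ Γ : Matrix (Fin r) (Fin r) ℝ,
      HasDerivAt (fun s : ℝ => factorImbalanceDeriv (w + s • z) z) Γ t :=
  ⟨_, (((hasDerivAt_const t z.fstᵀ).matrix_mul (hasDerivAt_fst_line w z t)).add
      ((hasDerivAt_fst_line w z t).matrix_transpose.matrix_mul (hasDerivAt_const t z.fst))).sub
    (((hasDerivAt_const t z.sndᵀ).matrix_mul (hasDerivAt_snd_line w z t)).add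
      ((hasDerivAt_snd_line w z t).matrix_transpose.matrix_mul (hasDerivAt_const t z.snd)))⟩

theorem contDiff_regFactorObjective (hf : ContDiff ℝ 2 f) (μ : ℝ) :
    ContDiff ℝ 2 (regFactorObjective r f μ) :=
  (contDiff_factorObjective hf).add
    (contDiff_const.mul ((contDiff_factorImbalance).norm_sq ℝ))

theorem inner_gradient_regFactorObjective (hf : ContDiff ℝ 2 f) (μ : ℝ)
    (w z : FactorSpace p₁ p₂ r) :
    ⟪∇ (regFactorObjective r f μ) w, z⟫_ℝ = ⟪∇ (factorObjective r f) w, z⟫_ℝ +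
      μ * ⟪factorImbalance w, factorImbalanceDeriv w z⟫_ℝ := by
  have h1 := hasDerivAt_comp_curve (contDiff_regFactorObjective (r := r) hf μ)
    (hasDerivAt_line w z 0)
  have h2 := hasDerivAt_comp_curve (contDiff_factorObjective (r := r) hf) (hasDerivAt_line w z 0)
  have h3 := h1.unique
    (h2.add (((hasDerivAt_factorImbalance_line w z 0).norm_sq).const_mul (μ / 2)))
  rw [zero_smul, add_zero] at h3
  rw [h3]
  ring

/-- At balanced factors the regularizer adds `μ ‖D(LᵀL - RᵀR)[z]‖²` to the Hessian form. -/
theorem inner_euclideanHessian_regFactorObjective (hf : ContDiff ℝ 2 f) (μ : ℝ)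
    {w : FactorSpace p₁ p₂ r} (hw : factorImbalance w = 0) (z : FactorSpace p₁ p₂ r) :
    ⟪euclideanHessian (regFactorObjective r f μ) w z, z⟫_ℝ =
      ⟪euclideanHessian (factorObjective r f) w z, z⟫_ℝ +
        μ * ‖factorImbalanceDeriv w z‖ ^ 2 := by
  have h1 := hasDerivAt_inner_gradient_line (contDiff_regFactorObjective (r := r) hf μ) w z
  have h2 := hasDerivAt_inner_gradient_line (contDiff_factorObjective (r := r) hf) w z
  obtain ⟨Γ, hΓ⟩ := hasDerivAt_factorImbalanceDeriv_line w z 0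
  have h3 := ((hasDerivAt_factorImbalance_line w z 0).inner ℝ hΓ).const_mul μ
  rw [zero_smul, add_zero, hw, inner_zero_left, zero_add, real_inner_self_eq_norm_sq] at h3
  simp only [inner_gradient_regFactorObjective hf μ] at h1
  exact h1.unique (h2.add h3)

/-- Critical points of the regularized objective are balanced: along `(LΔ, -RΔ)`, where
`Δ = LᵀL - RᵀR`, the product `L Rᵀ` is stationary to first order while `‖Δ‖²` has derivative
`4 (‖LΔ‖² + ‖RΔ‖²)`. -/
theorem factorImbalance_eq_zero (hf : ContDiff ℝ 2 f) {μ : ℝ} (hμ : 0 < μ)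
    {w : FactorSpace p₁ p₂ r} (hw : (factorProduct w).rank = r)
    (h : IsEuclideanFOSP (regFactorObjective r f μ) w) : factorImbalance w = 0 := by
  set D := factorImbalance w with hD
  have hDt : Dᵀ = D := transpose_factorImbalance w
  let z : FactorSpace p₁ p₂ r := WithLp.toLp 2 (w.fst * D, -(w.snd * D))
  have hz : factorTangent w z = 0 := by
    change w.fst * D * w.sndᵀ + w.fst * (-(w.snd * D))ᵀ = 0
    rw [Matrix.transpose_neg, Matrix.transpose_mul, hDt, Matrix.mul_neg, Matrix.mul_assoc,
      add_neg_cancel]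
  have hz' : factorImbalanceDeriv w z = (D * (w.fstᵀ * w.fst) + w.fstᵀ * w.fst * D) +
      (D * (w.sndᵀ * w.snd) + w.sndᵀ * w.snd * D) := by
    change (w.fst * D)ᵀ * w.fst + w.fstᵀ * (w.fst * D) -
      ((-(w.snd * D))ᵀ * w.snd + w.sndᵀ * (-(w.snd * D))) = _
    simp only [Matrix.transpose_neg, Matrix.transpose_mul, hDt, Matrix.mul_neg, Matrix.neg_mul,
      Matrix.mul_assoc]
    abel
  have h1 := isEuclideanFOSP_iff.1 h z
  rw [inner_gradient_regFactorObjective hf, inner_gradient_factorObjective hf, hz,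
    inner_zero_right, zero_add, ← hD, hz',
    inner_add_right, inner_add_right, inner_add_right, Matrix.inner_self_mul_gram,
    Matrix.inner_self_mul_gram, Matrix.inner_self_gram_mul, Matrix.inner_self_gram_mul, hDt] at h1
  have h2 := (mul_eq_zero.1 h1).resolve_left hμ.ne'
  have h3 : ‖w.fst * D‖ ^ 2 = 0 := by
    nlinarith [sq_nonneg ‖w.fst * D‖, sq_nonneg ‖w.snd * D‖]
  exact Matrix.eq_zero_of_mul_eq_zero_of_card_le_rank (le_rank_fst hw)
    (norm_eq_zero.1 ((pow_eq_zero_iff two_ne_zero).1 h3))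

theorem isEuclideanFOSP_regFactorObjective_iff (hf : ContDiff ℝ 2 f) {μ : ℝ} (hμ : 0 < μ)
    {w : FactorSpace p₁ p₂ r} (hw : (factorProduct w).rank = r) :
    IsEuclideanFOSP (regFactorObjective r f μ) w ↔
      IsEuclideanFOSP (factorObjective r f) w ∧ factorImbalance w = 0 := by
  have key (h0 : factorImbalance w = 0) : IsEuclideanFOSP (regFactorObjective r f μ) w ↔
      IsEuclideanFOSP (factorObjective r f) w := by
    simp only [isEuclideanFOSP_iff, inner_gradient_regFactorObjective hf, h0,
      inner_zero_left, mul_zero, add_zero]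
  exact ⟨fun h => ⟨(key (factorImbalance_eq_zero hf hμ hw h)).1 h,
    factorImbalance_eq_zero hf hμ hw h⟩, fun h => (key h.2).2 h.1⟩

/-- At balanced factors every direction `z` can be moved along the fibre of the factorization map,
by `(LS, -RSᵀ)`, so that the imbalance is stationary to first order. The condition on `S` is a
Lyapunov equation. -/
theorem exists_factorTangent_eq_factorImbalanceDeriv_eq_zero {w : FactorSpace p₁ p₂ r}
    (hw : (factorProduct w).rank = r) (h0 : factorImbalance w = 0) (z : FactorSpace p₁ p₂ r) :
    ∃ z', factorTangent w z' = factorTangent w z ∧ factorImbalanceDeriv w z' = 0 := by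
  -- Half of the correction is needed, as `S` and `Sᵀ` contribute equally.
  obtain ⟨S, hS⟩ := Matrix.exists_lyapunov (le_rank_fst hw)
    (-(1 / 2 : ℝ) • factorImbalanceDeriv w z)
  have hSt := congrArg Matrix.transpose hS
  rw [Matrix.transpose_smul, transpose_factorImbalanceDeriv] at hSt
  simp only [Matrix.transpose_add, Matrix.transpose_mul, Matrix.transpose_transpose] at hSt
  have hbal : w.sndᵀ * w.snd = w.fstᵀ * w.fst := (sub_eq_zero.1 h0).symm
  refine ⟨WithLp.toLp 2 (z.fst + w.fst * S, z.snd - w.snd * Sᵀ), ?_, ?_⟩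
  · change (z.fst + w.fst * S) * w.sndᵀ + w.fst * (z.snd - w.snd * Sᵀ)ᵀ = _
    rw [factorTangent_apply, Matrix.transpose_sub, Matrix.transpose_mul,
      Matrix.transpose_transpose, Matrix.add_mul, Matrix.mul_sub, Matrix.mul_assoc]
    abel
  · change (z.fst + w.fst * S)ᵀ * w.fst + w.fstᵀ * (z.fst + w.fst * S) -
      ((z.snd - w.snd * Sᵀ)ᵀ * w.snd + w.sndᵀ * (z.snd - w.snd * Sᵀ)) = 0
    have h1 : (z.fst + w.fst * S)ᵀ * w.fst + w.fstᵀ * (z.fst + w.fst * S) -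
        ((z.snd - w.snd * Sᵀ)ᵀ * w.snd + w.sndᵀ * (z.snd - w.snd * Sᵀ)) =
        factorImbalanceDeriv w z + (S * (w.fstᵀ * w.fst) + w.fstᵀ * w.fst * S) +
          (w.fstᵀ * w.fst * Sᵀ + Sᵀ * (w.fstᵀ * w.fst)) := by
      have h2 : S * (w.sndᵀ * w.snd) = S * (w.fstᵀ * w.fst) := by rw [hbal]
      have h3 : w.sndᵀ * (w.snd * Sᵀ) = w.fstᵀ * (w.fst * Sᵀ) := by
        rw [← Matrix.mul_assoc, hbal, Matrix.mul_assoc]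
      simp only [factorImbalanceDeriv, Matrix.transpose_add, Matrix.transpose_sub,
        Matrix.transpose_mul, Matrix.transpose_transpose, Matrix.add_mul, Matrix.sub_mul,
        Matrix.mul_add, Matrix.mul_sub, Matrix.mul_assoc, h2, h3]
      abel
    rw [h1, hS, add_assoc, add_comm (w.fstᵀ * w.fst * Sᵀ)]
    rw [add_comm (Sᵀ * _), hSt]
    module

theorem isEuclideanSOSP_regFactorObjective_iff (hf : ContDiff ℝ 2 f) {μ : ℝ} (hμ : 0 < μ)
    {w : FactorSpace p₁ p₂ r} (hw : (factorProduct w).rank = r) :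
    IsEuclideanSOSP (regFactorObjective r f μ) w ↔
      IsEuclideanSOSP (factorObjective r f) w ∧ factorImbalance w = 0 := by
  constructor
  · rintro ⟨hg, hH⟩
    obtain ⟨hg', h0⟩ := (isEuclideanFOSP_regFactorObjective_iff hf hμ hw).1 hg
    refine ⟨⟨hg', fun z => ?_⟩, h0⟩
    obtain ⟨-, hgrad⟩ := (isRiemannianFOSP_iff_isEuclideanFOSP hf hw).2 hg'
    obtain ⟨z', hz', hz0⟩ := exists_factorTangent_eq_factorImbalanceDeriv_eq_zero hw h0 z
    have hz : factorTangent w z ∈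
        tangentSpaceOf (fixedRankManifold p₁ p₂ r) (factorProduct w) := by
      rw [tangentSpaceOf_fixedRankManifold hw]
      exact ⟨z, rfl⟩
    have h1 := hH z'
    rw [inner_euclideanHessian_regFactorObjective hf μ h0, hz0, norm_zero,
      inner_euclideanHessian_factorObjective hf hw hgrad (Z := ⟨_, hz⟩) hz',
      ← inner_euclideanHessian_factorObjective hf hw hgrad (Z := ⟨_, hz⟩) (z := z) rfl] at h1
    simpa using h1
  · rintro ⟨⟨hg, hH⟩, h0⟩
    refine ⟨(isEuclideanFOSP_regFactorObjective_iff hf hμ hw).2 ⟨hg, h0⟩, fun z => ?_⟩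
    rw [inner_euclideanHessian_regFactorObjective hf μ h0]
    have := hH z
    positivity

end Objectives

theorem mainTheorem4 {p₁ p₂ r : ℕ} (hr : 0 < r) (hrp : r ≤ min p₁ p₂)
    (f : Matrix (Fin p₁) (Fin p₂) ℝ → ℝ) (hf : ContDiff ℝ 2 f) (μ : ℝ) (hμ : 0 < μ) :
    (∀ (L : Matrix (Fin p₁) (Fin r) ℝ) (R : Matrix (Fin p₂) (Fin r) ℝ), (L * Rᵀ).rank = r →
      (IsEuclideanFOSP (factorObjective r f) (factorPair L R) →
        IsRiemannianFOSP (fixedRankManifold p₁ p₂ r) f (L * Rᵀ)) ∧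
      (IsEuclideanSOSP (factorObjective r f) (factorPair L R) →
        IsRiemannianSOSP (fixedRankManifold p₁ p₂ r) f (L * Rᵀ)) ∧
      (IsEuclideanFOSP (regFactorObjective r f μ) (factorPair L R) →
        IsRiemannianFOSP (fixedRankManifold p₁ p₂ r) f (L * Rᵀ)) ∧
      (IsEuclideanSOSP (regFactorObjective r f μ) (factorPair L R) →
        IsRiemannianSOSP (fixedRankManifold p₁ p₂ r) f (L * Rᵀ))) ∧
    (∀ X : Matrix (Fin p₁) (Fin p₂) ℝ,
      (IsRiemannianFOSP (fixedRankManifold p₁ p₂ r) f X →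
        ∀ (L : Matrix (Fin p₁) (Fin r) ℝ) (R : Matrix (Fin p₂) (Fin r) ℝ), L * Rᵀ = X →
          IsEuclideanFOSP (factorObjective r f) (factorPair L R) ∧
          (Lᵀ * L = Rᵀ * R → IsEuclideanFOSP (regFactorObjective r f μ) (factorPair L R))) ∧
      (IsRiemannianSOSP (fixedRankManifold p₁ p₂ r) f X →
        ∀ (L : Matrix (Fin p₁) (Fin r) ℝ) (R : Matrix (Fin p₂) (Fin r) ℝ), L * Rᵀ = X →
          IsEuclideanSOSP (factorObjective r f) (factorPair L R) ∧
          (Lᵀ * L = Rᵀ * R →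
            IsEuclideanSOSP (regFactorObjective r f μ) (factorPair L R)))) := by
  refine ⟨fun L R hw => ?_, fun X => ⟨?_, ?_⟩⟩
  · replace hw : (factorProduct (factorPair L R)).rank = r := hw
    have h1 := isRiemannianFOSP_iff_isEuclideanFOSP hf hw
    have h2 := isRiemannianSOSP_iff_isEuclideanSOSP hf hw
    exact ⟨h1.2, h2.2,
      fun h => h1.2 ((isEuclideanFOSP_regFactorObjective_iff hf hμ hw).1 h).1,
      fun h => h2.2 ((isEuclideanSOSP_regFactorObjective_iff hf hμ hw).1 h).1⟩
  · rintro hX L R rfl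
    have hw : (factorProduct (factorPair L R)).rank = r := hX.1
    have h1 := (isRiemannianFOSP_iff_isEuclideanFOSP hf hw).1 hX
    exact ⟨h1, fun hLR => (isEuclideanFOSP_regFactorObjective_iff hf hμ hw).2
      ⟨h1, sub_eq_zero.2 hLR⟩⟩
  · rintro hX L R rfl
    have hw : (factorProduct (factorPair L R)).rank = r := hX.1
    have h1 := (isRiemannianSOSP_iff_isEuclideanSOSP hf hw).1 hX
    exact ⟨h1, fun hLR => (isEuclideanSOSP_regFactorObjective_iff hf hμ hw).2
      ⟨h1, sub_eq_zero.2 hLR⟩⟩
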